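/- All manifolds are smooth and paracompact. Let $\kappa\colon F\to M$ be a fibred manifold (for instance a fibre bundle), $\dim M=m>1$, $\dim F=m+n$, let $\eta$ be a volume form on $M$, let $\Omega$ be a closed $(m+1)$-form on $F$ with $i(Z_1)i(Z_2)i(Z_3)\Omega=0$ for all $\kappa$-vertical $Z_1,Z_2,Z_3$, and let $\nabla$ be an Ehresmann connection in $\kappa$, with horizontal bundle $\mathrm H(\nabla)$; write $\mathrm V(\kappa)=\ker \mathrm T\kappa$, and ${}^H,{}^V$ for the horizontal and vertical components. For $y\in F$ let $(\mathrm T_y\kappa_{\mathrm H(\nabla)})^{-1}\colon \mathrm T_{\kappa(y)}M\to \mathrm H_y(\nabla)$ be the horizontal lift, let $\mathcal Y(y)$ be the horizontal lift of the $m$-vector $\mathcal Z$ at $\kappa(y)$ with $\eta(\mathcal Z)=1$, and let $\gamma=i(\mathcal Y)\Omega$, where $i(w_1\wedge\dots\wedge w_m)\Omega=\Omega(w_1,\dots,w_m,\cdot)$. For a submanifold $C\subseteq F$, $y\in C$ and a linear map $h\colon \mathrm T_{\kappa(y)}M\to \mathrm T_yC$ put $$\flat_y(h)=\bigl(h^H,\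 i\bigl(i(h^V\circ \mathrm T_y\kappa)\mathcal Y\bigr)\Omega|_{\mathrm V_y(\kappa)}\bigr)\in W_y:=\mathrm{Lin}(\mathrm T_{\kappa(y)}M,\mathrm H_y(\nabla))\times \mathrm V_y^*(\kappa),$$ where $i(A)(w_1\wedge\dots\wedge w_m)=\sum_\alpha w_1\wedge\dots\wedge Aw_\alpha\wedge\dots\wedge w_m$. The orthogonal complement of $\mathrm T_yC$ is the annihilator $$(\mathrm T_y^\perp C)^\nabla_\Omega=(\operatorname{Im}\flat_y)^0\subseteq W_y^*=(\mathrm T_{\kappa(y)}M\otimes \mathrm V_y(\kappa)^0)\times \mathrm V_y(\kappa),$$ for the pairing $\langle (h^*,Z),(u,\psi)\rangle=h^*(u)+\psi(Z)$, $(x\otimes\beta)(u)=\beta(u(x))$. Let $\sigma$ be the section $\sigma(y)=\bigl((\mathrm T_y\kappa_{\mathrm H(\nabla)})^{-1},-\gamma(y)|_{\mathrm V_y(\kappa)}\bigr)$ of $W$. Put $C_0=F$ and, for $i\ge1$, let $C_i$ be the set of the $y\in C_{i-1}$ for which there is a linear map $h\colon \mathrm T_{\kappa(y)}M\to \mathrm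 T_yC_{i-1}$ with $\flat_y(h)=\sigma(y)$. Assume that every $C_i$ is a regular (embedded) submanifold of $F$. Theorem. Let $i\ge 1$. (1) $C_i$ is the set of the points $y\in C_{i-1}$ at which the field equations have a solution tangent to $C_{i-1}$, that is, for which there is a linear map $h\colon \mathrm T_{\kappa(y)}M\to \mathrm T_yC_{i-1}$ with $\mathrm T_y\kappa\circ h=\mathrm{Id}$ and $\Omega(h(X_1),\dots,h(X_m),Y)=0$ for all $X_1,\dots,X_m\in \mathrm T_{\kappa(y)}M$ and $Y\in \mathrm T_yF$. (2) $C_i=\{y\in C_{i-1} : \langle p,\sigma(y)\rangle=0\text{ for all }p\in(\mathrm T^\perp_yC_{i-1})^\nabla_\Omega\}$. (3) Suppose that $(\mathrm T^\perp C_{i-1})^\nabla_\Omega$ is a vector subbundle of rank $r$, that is, $\dim(\mathrm T_y^\perp C_{i-1})^\nabla_\Omega=r$ for every $y\in C_{i-1}$. Let $U\subseteq F$ be open and let $(h^*_1,Z_1),\dots,(h^*_r,Z_r)$ be smooth sections of $W^*$ over $U$ that span $(\mathrm T_y^\perp C_{i-1})^\nabla_\Omega$ at every $y\in C_{i-1}\cap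 U$. Then the functions $\xi_j=\langle(h_j^*,Z_j),\sigma\rangle$ (the $i$th-generation constraints) are smooth on $U$, and $C_i\cap U=\{y\in C_{i-1}\cap U : \xi_1(y)=\dots=\xi_r(y)=0\}$. -/

import Mathlib

open scoped Manifold ContDiff Topology

namespace PreMultisymplectic

/-! ### Linear theory

`σ : W → E` is a surjection, `nab : E → W` a linear section of it (so `W = range nab ⊕ ker σ`),
`η` a volume element on `E`, `Ω` an `(m+1)`-form on `W`. -/

section Linear

variable {m : ℕ} {E W : Type*} [AddCommGroup E] [Module ℝ E] [AddCommGroup W] [Module ℝ W]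

/-- The horizontal projection of `W`, with values in the horizontal subspace `H(∇) = Im ∇`. -/
def horProj (σ : W →ₗ[ℝ] E) (nab : E →ₗ[ℝ] W) : W →ₗ[ℝ] LinearMap.range nab :=
  nab.rangeRestrict ∘ₗ σ

/-- The vertical projection `w ↦ w - w^H` of `W`. -/
def vertProj (σ : W →ₗ[ℝ] E) (nab : E →ₗ[ℝ] W) : W →ₗ[ℝ] W :=
  LinearMap.id - (LinearMap.range nab).subtype ∘ₗ horProj σ nab

/-- The endomorphism `h^V ∘ σ` of `W` attached to a linear map `h : E → W`, where `h^V` is the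
vertical component of `h`. -/
def vertTilde (σ : W →ₗ[ℝ] E) (nab h : E →ₗ[ℝ] W) : W →ₗ[ℝ] W :=
  (vertProj σ nab ∘ₗ h) ∘ₗ σ

/-- The contraction `i(w₁ ∧ ⋯ ∧ wₘ)Ω`, i.e. the covector `v ↦ Ω(w₁, …, wₘ, v)`. -/
def contract (Ω : W [⋀^Fin (m + 1)]→ₗ[ℝ] ℝ) (w : Fin m → W) : W →ₗ[ℝ] ℝ :=
  Ω.toMultilinearMap.curryRight w

/-- Let `Z` be the `m`-vector on `E` with `η(Z) = 1`, that is `Z = η(e)⁻¹ e₁ ∧ ⋯ ∧ eₘ` for any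
basis `e` of `E`, and let `Y = Λᵐ∇(Z) = η(e)⁻¹ ∇e₁ ∧ ⋯ ∧ ∇eₘ`. This is the covector
`γ = i(Y)Ω`. It does not depend on `e`. -/
noncomputable def gammaForm (e : Module.Basis (Fin m) ℝ E) (η : E [⋀^Fin m]→ₗ[ℝ] ℝ)
    (Ω : W [⋀^Fin (m + 1)]→ₗ[ℝ] ℝ) (nab : E →ₗ[ℝ] W) : W →ₗ[ℝ] ℝ :=
  (η e)⁻¹ • contract Ω (fun α => nab (e α))

/-- With `Y` as above and `A` an endomorphism of `W`, this is the covector `i(i(A)Y)Ω`, where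
`i(A)` acts on `m`-vectors as a derivation:
`i(A)(w₁ ∧ ⋯ ∧ wₘ) = ∑ α, w₁ ∧ ⋯ ∧ A w_α ∧ ⋯ ∧ wₘ`. -/
noncomputable def derivedForm (e : Module.Basis (Fin m) ℝ E) (η : E [⋀^Fin m]→ₗ[ℝ] ℝ)
    (Ω : W [⋀^Fin (m + 1)]→ₗ[ℝ] ℝ) (nab : E →ₗ[ℝ] W) (A : W →ₗ[ℝ] W) : W →ₗ[ℝ] ℝ :=
  (η e)⁻¹ • ∑ α : Fin m,
    contract Ω (Function.update (fun β => nab (e β)) α (A (nab (e α))))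

/-- The space `Lin(E, H(∇)) × V(σ)^*`. -/
abbrev PairSpace (σ : W →ₗ[ℝ] E) (nab : E →ₗ[ℝ] W) : Type _ :=
  (E →ₗ[ℝ] LinearMap.range nab) × Module.Dual ℝ (LinearMap.ker σ)

/-- The map `♭ : Lin(E, C) → Lin(E, H(∇)) × V(σ)^*`,
`h ↦ (h^H, i(i(h^V ∘ σ)Y)Ω|_{V(σ)})`. -/
noncomputable def flat (e : Module.Basis (Fin m) ℝ E) (η : E [⋀^Fin m]→ₗ[ℝ] ℝ)
    (Ω : W [⋀^Fin (m + 1)]→ₗ[ℝ] ℝ) (σ : W →ₗ[ℝ] E) (nab : E →ₗ[ℝ] W) (C : Submodule ℝ W)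
    (h : E →ₗ[ℝ] C) : PairSpace σ nab :=
  (horProj σ nab ∘ₗ (C.subtype ∘ₗ h),
    (derivedForm e η Ω nab (vertTilde σ nab (C.subtype ∘ₗ h))).domRestrict (LinearMap.ker σ))

/-- The element `((σ|_{H(∇)})⁻¹, -γ|_{V(σ)})` of `Lin(E, H(∇)) × V(σ)^*`; its first component is
the horizontal lift `E → H(∇)`, i.e. `nab` itself. -/
noncomputable def target (e : Module.Basis (Fin m) ℝ E) (η : E [⋀^Fin m]→ₗ[ℝ] ℝ)
    (Ω : W [⋀^Fin (m + 1)]→ₗ[ℝ] ℝ) (σ : W →ₗ[ℝ] E) (nab : E →ₗ[ℝ] W) : PairSpace σ nab :=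
  (nab.rangeRestrict, (-gammaForm e η Ω nab).domRestrict (LinearMap.ker σ))

/-- The space `E ⊗ V(σ)⁰`, realised as the linear maps `W → E` that vanish on `V(σ)`: the tensor
`x ⊗ β` is the map `w ↦ β(w) x`. -/
def horDual (σ : W →ₗ[ℝ] E) : Submodule ℝ (W →ₗ[ℝ] E) where
  carrier := {A | ∀ v ∈ LinearMap.ker σ, A v = 0}
  add_mem' := by
    intro A B hA hB v hv
    simp [hA v hv, hB v hv]
  zero_mem' := by
    intro v _
    simp
  smul_mem' := by
    intro c A hA v hv
    simp [hA v hv]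

/-- The space `(E ⊗ V(σ)⁰) × V(σ)`, the dual of `Lin(E, H(∇)) × V(σ)^*`. -/
abbrev DualPairSpace (σ : W →ₗ[ℝ] E) : Type _ :=
  horDual σ × LinearMap.ker σ

/-- The duality pairing `⟨(h*, Z), (u, ψ)⟩ = h*(u) + ψ(Z)`, where `h*(u)` is the natural
contraction, `(x ⊗ β)(u) = β(u(x))`, i.e. the trace of `h* ∘ u`. -/
noncomputable def pairing (σ : W →ₗ[ℝ] E) (nab : E →ₗ[ℝ] W) :
    DualPairSpace σ →ₗ[ℝ] PairSpace σ nab →ₗ[ℝ] ℝ :=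
  LinearMap.mk₂ ℝ
    (fun p q => LinearMap.trace ℝ E ((p.1 : W →ₗ[ℝ] E) ∘ₗ (LinearMap.range nab).subtype ∘ₗ q.1)
      + q.2 p.2)
    (by intro p p' q; simp [LinearMap.add_comp]; ring)
    (by intro c p q; simp [LinearMap.smul_comp]; ring)
    (by intro p q q'; simp [LinearMap.comp_add]; ring)
    (by intro c p q; simp [LinearMap.comp_smul]; ring)

/-- The orthogonal complement of `C` with respect to `Ω` and `∇`: the annihilator `(Im ♭)⁰`. -/
noncomputable def orthComplement (e : Module.Basis (Fin m) ℝ E) (η : E [⋀^Fin m]→ₗ[ℝ] ℝ)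
    (Ω : W [⋀^Fin (m + 1)]→ₗ[ℝ] ℝ) (σ : W →ₗ[ℝ] E) (nab : E →ₗ[ℝ] W) (C : Submodule ℝ W) :
    Submodule ℝ (DualPairSpace σ) where
  carrier := {p | ∀ h : E →ₗ[ℝ] C, pairing σ nab p (flat e η Ω σ nab C h) = 0}
  add_mem' := by
    intro p q hp hq h
    rw [map_add, LinearMap.add_apply, hp h, hq h, add_zero]
  zero_mem' := by
    intro h
    rw [map_zero, LinearMap.zero_apply]
  smul_mem' := by
    intro c p hp h
    rw [map_smul, LinearMap.smul_apply, hp h, smul_zero]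

end Linear

/-! ### Manifolds, forms, submanifolds -/

section Manifold

/-- A (not necessarily smooth) field of exterior `k`-forms on a `d`-dimensional manifold. -/
abbrev FormField (d k : ℕ) (N : Type*) [TopologicalSpace N]
    [ChartedSpace (EuclideanSpace ℝ (Fin d)) N] : Type _ :=
  ∀ y : N, TangentSpace (𝓡 d) y [⋀^Fin k]→L[ℝ] ℝ

/-- The expression of a field of forms in the preferred chart at `y₀`: its pullback under the
inverse of the chart, a field of forms on the target of the chart. -/
noncomputable def chartExpr {d k : ℕ} {N : Type*} [TopologicalSpace N]
    [ChartedSpace (EuclideanSpace ℝ (Fin d)) N] (α : FormField d k N) (y₀ : N)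
    (u : EuclideanSpace ℝ (Fin d)) : EuclideanSpace ℝ (Fin d) [⋀^Fin k]→L[ℝ] ℝ :=
  (α ((extChartAt (𝓡 d) y₀).symm u)).compContinuousLinearMap
    (mfderiv (𝓡 d) (𝓡 d) (extChartAt (𝓡 d) y₀).symm u)

/-- The field of forms is smooth. -/
def IsSmoothForm {d k : ℕ} {N : Type*} [TopologicalSpace N]
    [ChartedSpace (EuclideanSpace ℝ (Fin d)) N] (α : FormField d k N) : Prop :=
  ∀ y₀ : N, ContDiffOn ℝ ∞ (chartExpr α y₀) (extChartAt (𝓡 d) y₀).target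

/-- The (smooth) form is closed. -/
def IsClosedForm {d k : ℕ} {N : Type*} [TopologicalSpace N]
    [ChartedSpace (EuclideanSpace ℝ (Fin d)) N] (α : FormField d k N) : Prop :=
  ∀ y₀ : N, ∀ u ∈ (extChartAt (𝓡 d) y₀).target, extDeriv (chartExpr α y₀) u = 0

/-- `S` is a regular submanifold: it carries (for the subspace topology) a smooth structure such
that the inclusion is a smooth embedding. -/
def IsRegularSubmanifold {d : ℕ} {N : Type*} [TopologicalSpace N]
    [ChartedSpace (EuclideanSpace ℝ (Fin d)) N] (S : Set N) : Prop :=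
  ∃ (c : ℕ) (_ : ChartedSpace (EuclideanSpace ℝ (Fin c)) S),
    IsManifold (𝓡 c) ∞ S ∧ Manifold.IsSmoothEmbedding (𝓡 c) (𝓡 d) ∞ (Subtype.val : S → N)

/-- The tangent space `T_y S ⊆ T_y N` of a regular submanifold `S` at `y ∈ S`: the (span of the)
velocities at `y` of the smooth curves of `N` that run in `S`. -/
noncomputable def tangentTo {d : ℕ} {N : Type*} [TopologicalSpace N]
    [ChartedSpace (EuclideanSpace ℝ (Fin d)) N] (S : Set N) (y : N) :
    Submodule ℝ (TangentSpace (𝓡 d) y) :=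
  Submodule.span ℝ {v | ∃ c : ℝ → N, ContMDiffAt 𝓘(ℝ, ℝ) (𝓡 d) ∞ c 0 ∧
    (∀ᶠ t in 𝓝 (0 : ℝ), c t ∈ S) ∧
    tangentMap 𝓘(ℝ, ℝ) (𝓡 d) c ⟨0, (1 : ℝ)⟩ = (⟨y, v⟩ : TangentBundle (𝓡 d) N)}

end Manifold

/-! ### Systems and connections -/

section System

/-- A system `(F, Ω, ω = κ^*η)`: a fibred manifold `κ : F → M` with `dim M = m`,
`dim F = m + n`, a volume form `η` on `M`, and a closed `(m+1)`-form `Ω` on `F`. -/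
structure FieldSystem (m n : ℕ) (M F : Type*)
    [TopologicalSpace M] [ChartedSpace (EuclideanSpace ℝ (Fin m)) M]
    [TopologicalSpace F] [ChartedSpace (EuclideanSpace ℝ (Fin (m + n))) F] where
  κ : F → M
  κ_smooth : ContMDiff (𝓡 (m + n)) (𝓡 m) ∞ κ
  κ_surjective : Function.Surjective κ
  κ_submersion : ∀ y, Function.Surjective (mfderiv (𝓡 (m + n)) (𝓡 m) κ y)
  η : FormField m m M
  η_smooth : IsSmoothForm η
  η_ne_zero : ∀ x, η x ≠ 0
  Ω : FormField (m + n) (m + 1) F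
  Ω_smooth : IsSmoothForm Ω
  Ω_closed : IsClosedForm Ω

variable {m n : ℕ} {M F : Type*}
  [TopologicalSpace M] [ChartedSpace (EuclideanSpace ℝ (Fin m)) M]
  [TopologicalSpace F] [ChartedSpace (EuclideanSpace ℝ (Fin (m + n))) F]

namespace FieldSystem

/-- The tangent map `T_y κ` as a linear map. -/
noncomputable def dκ (S : FieldSystem m n M F) (y : F) :
    TangentSpace (𝓡 (m + n)) y →ₗ[ℝ] TangentSpace (𝓡 m) (S.κ y) :=
  (mfderiv (𝓡 (m + n)) (𝓡 m) S.κ y).toLinearMap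

/-- `Ω` vanishes when three of its arguments are vertical. -/
def VanishesOnThreeVertical (S : FieldSystem m n M F) : Prop :=
  ∀ (y : F) (v : Fin (m + 1) → TangentSpace (𝓡 (m + n)) y) (i j k : Fin (m + 1)),
    i ≠ j → i ≠ k → j ≠ k →
    v i ∈ LinearMap.ker (S.dκ y) → v j ∈ LinearMap.ker (S.dκ y) →
    v k ∈ LinearMap.ker (S.dκ y) → S.Ω y v = 0

end FieldSystem

variable [IsManifold (𝓡 (m + n)) ∞ F]

/-- An Ehresmann connection in `κ : F → M`, given by its horizontal lifts
`T_{κ(y)} M → T_y F`. Smoothness is that of the bundle map `v ↦ v^H` of `TF`. -/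
structure Connection (S : FieldSystem m n M F) where
  lift : ∀ y : F, TangentSpace (𝓡 m) (S.κ y) →ₗ[ℝ] TangentSpace (𝓡 (m + n)) y
  isSection : ∀ (y : F) (x : TangentSpace (𝓡 m) (S.κ y)), S.dκ y (lift y x) = x
  smooth : ContMDiff (𝓡 (m + n)).tangent (𝓡 (m + n)).tangent ∞
    (fun v : TangentBundle (𝓡 (m + n)) F =>
      (⟨v.proj, lift v.proj (S.dκ v.proj v.snd)⟩ : TangentBundle (𝓡 (m + n)) F))

/-- A basis of `T_x M`, the standard basis of the model space. (Only used to write down the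
`m`-vector `Y`, which does not depend on the basis.) -/
noncomputable def frame (m : ℕ) {M : Type*} [TopologicalSpace M]
    [ChartedSpace (EuclideanSpace ℝ (Fin m)) M] (x : M) :
    Module.Basis (Fin m) ℝ (TangentSpace (𝓡 m) x) :=
  (EuclideanSpace.basisFun (Fin m) ℝ).toBasis

namespace FieldSystem

variable (S : FieldSystem m n M F) (nabla : Connection S)

/-- The map `♭(y)` on `Lin(T_{κ(y)} M, C)`, for a subspace `C` of `T_y F`. -/
noncomputable def flatAt (y : F) (C : Submodule ℝ (TangentSpace (𝓡 (m + n)) y))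
    (h : TangentSpace (𝓡 m) (S.κ y) →ₗ[ℝ] C) : PairSpace (S.dκ y) (nabla.lift y) :=
  flat (frame m (S.κ y)) (S.η (S.κ y)).toAlternatingMap (S.Ω y).toAlternatingMap
    (S.dκ y) (nabla.lift y) C h

/-- The section `((Tκ_{H(∇)})⁻¹, -γ|_{V(κ)})` of the bundle with fibres
`Lin(T_{κ(y)} M, H_y(∇)) × V_y(κ)^*`. -/
noncomputable def targetAt (y : F) : PairSpace (S.dκ y) (nabla.lift y) :=
  target (frame m (S.κ y)) (S.η (S.κ y)).toAlternatingMap (S.Ω y).toAlternatingMap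
    (S.dκ y) (nabla.lift y)

/-- The orthogonal complement with respect to `Ω` and `∇` of the tangent space `T_y C`. -/
noncomputable def tangentOrth (C : Set F) (y : F) : Submodule ℝ (DualPairSpace (S.dκ y)) :=
  orthComplement (frame m (S.κ y)) (S.η (S.κ y)).toAlternatingMap (S.Ω y).toAlternatingMap
    (S.dκ y) (nabla.lift y) (tangentTo C y)

/-- The sequence of the constraint algorithm: `C₀ = F`, and `C_{i+1}` consists of the `y ∈ C_i`
for which there is `h : T_{κ(y)} M → T_y C_i` with `h^H` the horizontal lift and
`i(i(h^V ∘ T_yκ)Y)Ω = -γ` on `V_y(κ)`. -/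
def constraintSet : ℕ → Set F
  | 0 => Set.univ
  | i + 1 => {y | y ∈ constraintSet i ∧
      ∃ h : TangentSpace (𝓡 m) (S.κ y) →ₗ[ℝ] tangentTo (constraintSet i) y,
        S.flatAt nabla y (tangentTo (constraintSet i) y) h = S.targetAt nabla y}

/-- `h : T_{κ(y)} M → T_y C` solves the field equations at `y`: it is a section of `T_yκ`, and
`Ω(h X₁, …, h Xₘ, Y) = 0` for all `X₁, …, Xₘ ∈ T_{κ(y)} M` and `Y ∈ T_y F`. -/
def SolvesFieldEquations (y : F) (C : Submodule ℝ (TangentSpace (𝓡 (m + n)) y))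
    (h : TangentSpace (𝓡 m) (S.κ y) →ₗ[ℝ] C) : Prop :=
  (∀ x, S.dκ y (h x) = x) ∧
  ∀ (X : Fin m → TangentSpace (𝓡 m) (S.κ y)) (Y : TangentSpace (𝓡 (m + n)) y),
    contract (S.Ω y).toAlternatingMap (fun α => (h (X α) : TangentSpace (𝓡 (m + n)) y)) Y = 0

variable [IsManifold (𝓡 m) ∞ M] in
/-- Smoothness over `U` of a section `y ↦ (h*_y, Z_y)` of the bundle with fibres
`(T_{κ(y)} M ⊗ V_y(κ)⁰) × V_y(κ)`: `h*` is a smooth bundle map `TF → TM` over `κ`, and `Z` is a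
smooth vector field. -/
def IsSmoothDualSection (U : Set F) (s : ∀ y : F, DualPairSpace (S.dκ y)) : Prop :=
  ContMDiffOn (𝓡 (m + n)).tangent (𝓡 m).tangent ∞
    (fun v : TangentBundle (𝓡 (m + n)) F =>
      (⟨S.κ v.proj, ((s v.proj).1 : TangentSpace (𝓡 (m + n)) v.proj →ₗ[ℝ]
        TangentSpace (𝓡 m) (S.κ v.proj)) v.snd⟩ : TangentBundle (𝓡 m) M))
    {v | v.proj ∈ U} ∧
  ContMDiffOn (𝓡 (m + n)) (𝓡 (m + n)).tangent ∞
    (fun y : F => (⟨y, ((s y).2 : TangentSpace (𝓡 (m + n)) y)⟩ : TangentBundle (𝓡 (m + n)) F)) U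

/-- The function `ξ` obtained by pairing a section `(h*, Z)` with
`((Tκ_{H(∇)})⁻¹, -γ|_{V(κ)})`. -/
noncomputable def constraint (s : ∀ y : F, DualPairSpace (S.dκ y)) (y : F) : ℝ :=
  pairing (S.dκ y) (nabla.lift y) (s y) (S.targetAt nabla y)

end FieldSystem

end System

end PreMultisymplectic

/-! Claims (1) and (2) are linear algebra at a single point `y`, with `E = T_{κ(y)}M`, `W = T_yF`
and `C = T_yC_i`. The first component of `♭(h) = σ` says that `h` is a section of `T_yκ`, so each
`h(e_α)` is the lift of `e_α` plus a vertical vector. For vertical `Z`, expand `Ω(h e₁, …, h eₘ, Z)`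
in these vertical parts: terms of degree two or more contain three vertical arguments and vanish. Up
to the factor `η(e)`, the rest is `γ(Z)` plus the second component of `♭(h)` at `Z`, so the second
component of the equation is the field equation on vertical `Z`. Any `Y` is `h(σ Y)` plus a vertical
vector, where `σ` now stands for `T_yκ`, and the field equation holds along `h(σ Y)` because `m + 1`
vectors of `E` are dependent (`flat_eq_target_iff`). As `♭` is linear, the equation is solvable iff
every functional killing `Im ♭` kills the right-hand side; the pairing realises all functionals
(`exists_pairing_eq`, `exists_flat_eq_iff`). In (3), linearity of the pairing reduces the test to
spanning sections. Smoothness follows from `ξ = tr(h* ∘ lift) - γ(Z)` in charts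
(`contMDiffOn_constraint`). -/

namespace PreMultisymplectic

/-! ### Linear algebra at a point: the field equations -/

section LinearLemmas

variable {m : ℕ} {E W : Type*} [AddCommGroup E] [Module ℝ E] [AddCommGroup W] [Module ℝ W]

/-- The form `w ↦ Ω(w₁, …, wₘ, v)` as an alternating map in `w`. -/
def contractAlternating (Ω : W [⋀^Fin (m + 1)]→ₗ[ℝ] ℝ) (v : W) : W [⋀^Fin m]→ₗ[ℝ] ℝ :=
  { (LinearMap.applyₗ v).compMultilinearMap Ω.toMultilinearMap.curryRight with
    map_eq_zero_of_eq' := by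
      intro w i j hij hne
      refine Ω.map_eq_zero_of_eq _ (i := i.castSucc) (j := j.castSucc) ?_ ?_
      · simpa using hij
      · simpa using hne }

theorem contract_apply (Ω : W [⋀^Fin (m + 1)]→ₗ[ℝ] ℝ) (w : Fin m → W) (v : W) :
    contract Ω w v = Ω (Fin.snoc w v) := rfl

/-- If `Ω` vanishes on three vertical vectors, its contraction with a vertical vector is affine
in vertical increments of the remaining arguments. -/
theorem contract_add_of_vertical {V : Submodule ℝ W} {Ω : W [⋀^Fin (m + 1)]→ₗ[ℝ] ℝ}
    (hΩ : ∀ (v : Fin (m + 1) → W) (i j k : Fin (m + 1)), i ≠ j → i ≠ k → j ≠ k →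
      v i ∈ V → v j ∈ V → v k ∈ V → Ω v = 0)
    (a b : Fin m → W) (hb : ∀ α, b α ∈ V) {Z : W} (hZ : Z ∈ V) :
    contract Ω (a + b) Z =
      contract Ω a Z + ∑ α, contract Ω (Function.update a α (b α)) Z := by
  -- Beyond the constant and linear terms, the expansion of `a + b` runs over subsets with at least
  -- two entries from `b`; together with `Z` these give three vertical arguments.
  have key := (contractAlternating Ω Z).toMultilinearMap.map_add_eq_map_add_linearDeriv_add a b
  rw [MultilinearMap.linearDeriv_apply] at key
  refine key.trans (add_eq_left.2 (Finset.sum_eq_zero fun s hs => ?_))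
  · obtain ⟨i, hi, j, hj, hij⟩ := Finset.one_lt_card.1 (Finset.mem_filter.1 hs).2
    change Ω (Fin.snoc (s.piecewise b a) Z) = 0
    refine hΩ _ i.castSucc j.castSucc (Fin.last m) ?_ (Fin.castSucc_lt_last i).ne
      (Fin.castSucc_lt_last j).ne ?_ ?_ ?_
    · simpa using hij
    · simpa [hi] using hb i
    · simpa [hj] using hb j
    · simpa using hZ

variable {σ : W →ₗ[ℝ] E} {nab : E →ₗ[ℝ] W}

theorem horProj_coe (w : W) : (horProj σ nab w : W) = nab (σ w) := rfl

theorem vertProj_apply (w : W) : vertProj σ nab w = w - nab (σ w) := rfl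

theorem vertTilde_nab (hσ : ∀ x, σ (nab x) = x) (h : E →ₗ[ℝ] W) (x : E) :
    vertTilde σ nab h (nab x) = h x - nab (σ (h x)) := by
  simp [vertTilde, hσ, vertProj_apply]

theorem flat_fst_eq_target_fst_iff (hσ : ∀ x, σ (nab x) = x) {e : Module.Basis (Fin m) ℝ E}
    {η : E [⋀^Fin m]→ₗ[ℝ] ℝ} {Ω : W [⋀^Fin (m + 1)]→ₗ[ℝ] ℝ} {C : Submodule ℝ W}
    (h : E →ₗ[ℝ] C) :
    (flat e η Ω σ nab C h).1 = (target e η Ω σ nab).1 ↔ ∀ x, σ (h x) = x := by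
  have hinj : Function.Injective nab := Function.LeftInverse.injective hσ
  rw [LinearMap.ext_iff]
  refine forall_congr' fun x => ?_
  rw [Subtype.ext_iff]
  exact hinj.eq_iff

/-- The equation `♭(h) = ((σ|_{H(∇)})⁻¹, -γ|_{V(σ)})` is equivalent to the field equations. -/
theorem flat_eq_target_iff (hσ : ∀ x, σ (nab x) = x) {e : Module.Basis (Fin m) ℝ E}
    {η : E [⋀^Fin m]→ₗ[ℝ] ℝ} (hη : η ≠ 0) {Ω : W [⋀^Fin (m + 1)]→ₗ[ℝ] ℝ}
    (hΩ : ∀ (v : Fin (m + 1) → W) (i j k : Fin (m + 1)), i ≠ j → i ≠ k → j ≠ k →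
      v i ∈ LinearMap.ker σ → v j ∈ LinearMap.ker σ → v k ∈ LinearMap.ker σ → Ω v = 0)
    {C : Submodule ℝ W} (h : E →ₗ[ℝ] C) :
    flat e η Ω σ nab C h = target e η Ω σ nab ↔
      (∀ x, σ (h x) = x) ∧
        ∀ (X : Fin m → E) (Y : W), contract Ω (fun α => (h (X α) : W)) Y = 0 := by
  have hηe : (η e)⁻¹ ≠ 0 := inv_ne_zero ((η.map_basis_ne_zero_iff e).2 hη)
  rw [Prod.ext_iff, flat_fst_eq_target_fst_iff hσ]
  refine and_congr_right fun hsec => ?_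
  have hvert : ∀ α, (h (e α) : W) - nab (e α) ∈ LinearMap.ker σ := fun α => by
    rw [LinearMap.mem_ker, map_sub, hsec, hσ, sub_self]
  have hexp : ∀ Z ∈ LinearMap.ker σ, (η e)⁻¹ * contract Ω (fun α => (h (e α) : W)) Z =
      gammaForm e η Ω nab Z
        + derivedForm e η Ω nab (vertTilde σ nab (C.subtype ∘ₗ h)) Z := by
    intro Z hZ
    have := contract_add_of_vertical hΩ (fun α => nab (e α))
      (fun α => (h (e α) : W) - nab (e α)) hvert hZ
    have hsum : (fun α => nab (e α)) + (fun α => (h (e α) : W) - nab (e α)) =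
        fun α => (h (e α) : W) := by
      funext α
      simp
    rw [hsum] at this
    rw [this]
    simp only [gammaForm, derivedForm, LinearMap.smul_apply, smul_eq_mul, LinearMap.sum_apply,
      mul_add, vertTilde_nab hσ, LinearMap.comp_apply, Submodule.subtype_apply, hsec]
  have hsnd : (flat e η Ω σ nab C h).2 = (target e η Ω σ nab).2 ↔
      ∀ Z ∈ LinearMap.ker σ, contract Ω (fun α => (h (e α) : W)) Z = 0 := by
    rw [LinearMap.ext_iff, Subtype.forall]
    refine forall₂_congr fun Z hZ => ?_
    change derivedForm e η Ω nab (vertTilde σ nab (C.subtype ∘ₗ h)) Z =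
      -gammaForm e η Ω nab Z ↔ _
    rw [← mul_eq_zero_iff_left hηe (b := contract Ω _ Z), hexp Z hZ, add_comm,
      add_eq_zero_iff_eq_neg]
  rw [hsnd]
  constructor
  · intro H X Y
    -- All `m + 1` arguments come through `h` from the `m`-dimensional space `E`, so they are images
    -- of dependent vectors.
    have hhor : contract Ω (fun α => (h (e α) : W)) (h (σ Y)) = 0 := by
      have : FiniteDimensional ℝ E := e.finiteDimensional_of_finite
      have hdep : ¬ LinearIndependent ℝ (Fin.snoc e (σ Y) : Fin (m + 1) → E) := fun hli => by
        have := hli.fintype_card_le_finrank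
        rw [Module.finrank_eq_card_basis e, Fintype.card_fin, Fintype.card_fin] at this
        omega
      have h0 := (Ω.compLinearMap (C.subtype ∘ₗ h)).map_linearDependent _ hdep
      rw [contract_apply]
      rw [AlternatingMap.compLinearMap_apply] at h0
      convert h0 using 2
      funext k
      refine Fin.lastCases ?_ (fun i => ?_) k <;> simp
    have hbasis : contract Ω (fun α => (h (e α) : W)) Y = 0 := by
      have hker : Y - h (σ Y) ∈ LinearMap.ker σ := by
        rw [LinearMap.mem_ker, map_sub, hsec, sub_self]
      have := H _ hker
      rwa [map_sub, hhor, sub_zero] at this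
    -- An `m`-form on `E` that vanishes on one basis is zero, which frees `X` from the basis `e`.
    have hzero : (contractAlternating Ω Y).compLinearMap (C.subtype ∘ₗ h) = 0 :=
      ((contractAlternating Ω Y).compLinearMap (C.subtype ∘ₗ h)).map_basis_eq_zero_iff e |>.1
        hbasis
    exact DFunLike.congr_fun hzero X
  · exact fun H Z _ => H _ Z

/-! ### Linearity of `♭`, duality, and independence of the basis -/

theorem derivedForm_add (e : Module.Basis (Fin m) ℝ E) (η : E [⋀^Fin m]→ₗ[ℝ] ℝ)
    (Ω : W [⋀^Fin (m + 1)]→ₗ[ℝ] ℝ) (A B : W →ₗ[ℝ] W) :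
    derivedForm e η Ω nab (A + B) = derivedForm e η Ω nab A + derivedForm e η Ω nab B := by
  simp only [derivedForm, contract, LinearMap.add_apply, MultilinearMap.map_update_add,
    Finset.sum_add_distrib, smul_add]

theorem derivedForm_smul (e : Module.Basis (Fin m) ℝ E) (η : E [⋀^Fin m]→ₗ[ℝ] ℝ)
    (Ω : W [⋀^Fin (m + 1)]→ₗ[ℝ] ℝ) (c : ℝ) (A : W →ₗ[ℝ] W) :
    derivedForm e η Ω nab (c • A) = c • derivedForm e η Ω nab A := by
  simp only [derivedForm, contract, LinearMap.smul_apply, MultilinearMap.map_update_smul,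
    ← Finset.smul_sum, smul_comm c]

/-- `♭` as a linear map. -/
noncomputable def flatLinear (e : Module.Basis (Fin m) ℝ E) (η : E [⋀^Fin m]→ₗ[ℝ] ℝ)
    (Ω : W [⋀^Fin (m + 1)]→ₗ[ℝ] ℝ) (σ : W →ₗ[ℝ] E) (nab : E →ₗ[ℝ] W) (C : Submodule ℝ W) :
    (E →ₗ[ℝ] C) →ₗ[ℝ] PairSpace σ nab where
  toFun := flat e η Ω σ nab C
  map_add' h k := by
    have : vertTilde σ nab (C.subtype ∘ₗ (h + k)) =
        vertTilde σ nab (C.subtype ∘ₗ h) + vertTilde σ nab (C.subtype ∘ₗ k) := by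
      simp only [vertTilde, LinearMap.comp_add, LinearMap.add_comp]
    unfold flat
    rw [this, derivedForm_add, LinearMap.comp_add, LinearMap.comp_add]
    rfl
  map_smul' c h := by
    have : vertTilde σ nab (C.subtype ∘ₗ (c • h)) = c • vertTilde σ nab (C.subtype ∘ₗ h) := by
      simp only [vertTilde, LinearMap.comp_smul, LinearMap.smul_comp]
    unfold flat
    rw [this, derivedForm_smul, LinearMap.comp_smul, LinearMap.comp_smul]
    rfl

/-- Every linear functional on `Lin(E, H)` is of the form `u ↦ tr(A ∘ u)`. -/
theorem exists_trace_comp_eq [FiniteDimensional ℝ E] {H : Type*} [AddCommGroup H] [Module ℝ H]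
    (f : (E →ₗ[ℝ] H) →ₗ[ℝ] ℝ) :
    ∃ A : H →ₗ[ℝ] E, ∀ u : E →ₗ[ℝ] H, LinearMap.trace ℝ E (A ∘ₗ u) = f u := by
  -- In a basis `b`, the choice is `A(w) = ∑ f(bᵢ* ⊗ w) bᵢ`; the diagonal entries of `A ∘ u` are
  -- then `f(bᵢ* ⊗ u(bᵢ))`.
  let b := Module.finBasis ℝ E
  let A : H →ₗ[ℝ] E := ∑ i, (f ∘ₗ LinearMap.smulRightₗ (b.coord i)).smulRight (b i)
  refine ⟨A, fun u => ?_⟩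
  have hu : u = ∑ i, (b.coord i).smulRight (u (b i)) := by
    refine b.ext fun j => ?_
    simp [Finsupp.single_apply]
  rw [LinearMap.trace_eq_matrix_trace ℝ b, Matrix.trace]
  conv_rhs => rw [hu, map_sum]
  refine Finset.sum_congr rfl fun i _ => ?_
  simp [LinearMap.toMatrix_apply, A, Finsupp.single_apply]

/-- Every linear functional on `Lin(E, H(∇)) × V(σ)^*` is the pairing with some element of
`(E ⊗ V(σ)⁰) × V(σ)`. -/
theorem exists_pairing_eq [FiniteDimensional ℝ E] [FiniteDimensional ℝ W]
    (hσ : ∀ x, σ (nab x) = x) (f : PairSpace σ nab →ₗ[ℝ] ℝ) :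
    ∃ p : DualPairSpace σ, pairing σ nab p = f := by
  obtain ⟨A, hA⟩ := exists_trace_comp_eq (f ∘ₗ LinearMap.inl ℝ _ _)
  obtain ⟨Z, hZ⟩ := (Module.evalEquiv ℝ (LinearMap.ker σ)).surjective (f ∘ₗ LinearMap.inr ℝ _ _)
  -- `A` lives only on `H(∇)`; precomposing with the horizontal projection extends it to `W` by zero
  -- on vertical vectors.
  have hmem : A ∘ₗ horProj σ nab ∈ horDual σ := fun v hv => by
    have : horProj σ nab v = 0 := Subtype.ext (by
      rw [horProj_coe, LinearMap.mem_ker.1 hv, map_zero, ZeroMemClass.coe_zero])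
    rw [LinearMap.comp_apply, this, map_zero]
  refine ⟨(⟨_, hmem⟩, Z), LinearMap.ext fun q => ?_⟩
  have hproj : ∀ w : LinearMap.range nab, horProj σ nab w = w := by
    rintro ⟨_, x, rfl⟩
    exact Subtype.ext (by rw [horProj_coe, hσ])
  have h1 : (A ∘ₗ horProj σ nab) ∘ₗ (LinearMap.range nab).subtype ∘ₗ q.1 = A ∘ₗ q.1 :=
    LinearMap.ext fun x => by simp [hproj]
  have h2 : q.2 Z = f (0, q.2) := LinearMap.congr_fun hZ q.2
  change LinearMap.trace ℝ E ((A ∘ₗ horProj σ nab) ∘ₗ (LinearMap.range nab).subtype ∘ₗ q.1)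
    + q.2 Z = f q
  rw [h1, hA, h2, LinearMap.comp_apply, LinearMap.inl_apply, ← map_add, Prod.mk_add_mk, add_zero,
    zero_add]

/-- An element of `Lin(E, H(∇)) × V(σ)^*` is in the image of `♭` if and only if it is annihilated
by the orthogonal complement. -/
theorem exists_flat_eq_iff [FiniteDimensional ℝ E] [FiniteDimensional ℝ W]
    (hσ : ∀ x, σ (nab x) = x) {e : Module.Basis (Fin m) ℝ E}
    {η : E [⋀^Fin m]→ₗ[ℝ] ℝ} {Ω : W [⋀^Fin (m + 1)]→ₗ[ℝ] ℝ} {C : Submodule ℝ W}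
    (q : PairSpace σ nab) :
    (∃ h, flat e η Ω σ nab C h = q) ↔
      ∀ p ∈ orthComplement e η Ω σ nab C, pairing σ nab p q = 0 := by
  constructor
  · rintro ⟨h, rfl⟩ p hp
    exact hp h
  · intro H
    by_contra hq
    have hq' : q ∉ LinearMap.range (flatLinear e η Ω σ nab C) := hq
    obtain ⟨f, hfq, hf⟩ := Submodule.exists_le_ker_of_notMem hq'
    obtain ⟨p, rfl⟩ := exists_pairing_eq hσ f
    exact hfq (H p fun h => hf ⟨h, rfl⟩)

/-- The value of `γ` does not depend on the basis. -/
theorem gammaForm_apply_eq_of_basis (e b : Module.Basis (Fin m) ℝ E) (η : E [⋀^Fin m]→ₗ[ℝ] ℝ)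
    (Ω : W [⋀^Fin (m + 1)]→ₗ[ℝ] ℝ) (nab : E →ₗ[ℝ] W) (Z : W) :
    gammaForm e η Ω nab Z = (η b)⁻¹ * contract Ω (fun α => nab (b α)) Z := by
  have hdet : e.det b ≠ 0 := (e.isUnit_det b).ne_zero
  -- `g` and `η` are both `m`-forms on `E`, so a change of basis multiplies both by the same
  -- determinant and the ratio is unchanged.
  let g := (contractAlternating Ω Z).compLinearMap nab
  have h1 : η b = η e * e.det b := by
    conv_lhs => rw [η.eq_smul_basis_det e]
    rfl
  have h2 : g b = g e * e.det b := by
    conv_lhs => rw [g.eq_smul_basis_det e]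
    rfl
  change (η e)⁻¹ * g e = (η b)⁻¹ * g b
  rw [h1, h2]
  field_simp

end LinearLemmas

/-! ### Forms and bundle maps in preferred charts -/

section Coordinates

variable {d d' : ℕ} {N N' : Type*}
  [TopologicalSpace N] [ChartedSpace (EuclideanSpace ℝ (Fin d)) N] [IsManifold (𝓡 d) ∞ N]
  [TopologicalSpace N'] [ChartedSpace (EuclideanSpace ℝ (Fin d')) N'] [IsManifold (𝓡 d') ∞ N']

/-- The map from `T_y N` to the model space given by the preferred chart at `y₀`. -/
noncomputable def toCoord (y₀ y : N) : TangentSpace (𝓡 d) y →L[ℝ] EuclideanSpace ℝ (Fin d) :=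
  (trivializationAt (EuclideanSpace ℝ (Fin d)) (TangentSpace (𝓡 d)) y₀).continuousLinearMapAt ℝ y

/-- The map from the model space to `T_y N` given by the preferred chart at `y₀`. -/
noncomputable def ofCoord (y₀ y : N) : EuclideanSpace ℝ (Fin d) →L[ℝ] TangentSpace (𝓡 d) y :=
  (trivializationAt (EuclideanSpace ℝ (Fin d)) (TangentSpace (𝓡 d)) y₀).symmL ℝ y

variable {y₀ y : N}

theorem toCoord_ofCoord (hy : y ∈ (chartAt (EuclideanSpace ℝ (Fin d)) y₀).source)
    (v : EuclideanSpace ℝ (Fin d)) : toCoord y₀ y (ofCoord y₀ y v) = v :=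
  (trivializationAt (EuclideanSpace ℝ (Fin d)) (TangentSpace (𝓡 d)) y₀).continuousLinearMapAt_symmL
    (R := ℝ) hy v

theorem ofCoord_toCoord (hy : y ∈ (chartAt (EuclideanSpace ℝ (Fin d)) y₀).source)
    (v : TangentSpace (𝓡 d) y) : ofCoord y₀ y (toCoord y₀ y v) = v :=
  (trivializationAt (EuclideanSpace ℝ (Fin d)) (TangentSpace (𝓡 d)) y₀).symmL_continuousLinearMapAt
    (R := ℝ) hy v

theorem toCoord_eq_trivializationAt (hy : y ∈ (chartAt (EuclideanSpace ℝ (Fin d)) y₀).source)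
    (v : TangentSpace (𝓡 d) y) :
    (trivializationAt (EuclideanSpace ℝ (Fin d)) (TangentSpace (𝓡 d)) y₀ ⟨y, v⟩).2 =
      toCoord y₀ y v := by
  rw [toCoord, Bundle.Trivialization.continuousLinearMapAt_apply,
    Bundle.Trivialization.coe_linearMapAt_of_mem _ (by exact hy)]

omit [IsManifold (𝓡 d) ∞ N] in
theorem eventually_mem_chartAt_source (y₀ : N) :
    ∀ᶠ y in 𝓝 y₀, y ∈ (chartAt (EuclideanSpace ℝ (Fin d)) y₀).source :=
  (chartAt _ y₀).open_source.mem_nhds (mem_chart_source _ y₀)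

/-- The vector field with constant coordinates `v` in the preferred chart at `y₀` is smooth. -/
theorem contMDiffAt_ofCoord (y₀ : N) (v : EuclideanSpace ℝ (Fin d)) :
    ContMDiffAt (𝓡 d) (𝓡 d).tangent ∞
      (fun y => (⟨y, ofCoord y₀ y v⟩ : TangentBundle (𝓡 d) N)) y₀ := by
  rw [Bundle.contMDiffAt_totalSpace]
  refine ⟨contMDiffAt_id, (contMDiffAt_const (c := v)).congr_of_eventuallyEq ?_⟩
  filter_upwards [eventually_mem_chartAt_source (d := d) y₀] with y hy
  rw [toCoord_eq_trivializationAt hy, toCoord_ofCoord hy]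

/-- A field of linear maps `T_y N → T_{g(y)} N'` in the coordinates given by the preferred charts
at `y₀` and `g(y₀)`. -/
noncomputable def coordMap (y₀ : N) (g : N → N')
    (T : ∀ y, TangentSpace (𝓡 d) y →ₗ[ℝ] TangentSpace (𝓡 d') (g y)) (y : N) :
    EuclideanSpace ℝ (Fin d) →L[ℝ] EuclideanSpace ℝ (Fin d') :=
  LinearMap.toContinuousLinearMap
    ((toCoord (g y₀) (g y)).toLinearMap ∘ₗ T y ∘ₗ (ofCoord y₀ y).toLinearMap)

-- An operator on a finite-dimensional space is a fixed linear expression in its values on a basis,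
-- so smoothness can be tested vector by vector.
omit [IsManifold (𝓡 d) ∞ N] in
theorem contMDiffAt_clm_of_apply {k : ℕ} {G : Type*} [NormedAddCommGroup G] [NormedSpace ℝ G]
    {A : N → EuclideanSpace ℝ (Fin k) →L[ℝ] G}
    (hA : ∀ v, ContMDiffAt (𝓡 d) 𝓘(ℝ, G) ∞ (fun y => A y v) y₀) :
    ContMDiffAt (𝓡 d) 𝓘(ℝ, EuclideanSpace ℝ (Fin k) →L[ℝ] G) ∞ A y₀ := by
  let b := EuclideanSpace.basisFun (Fin k) ℝ
  have hsum : A = fun y => ∑ i, ContinuousLinearMap.smulRightL ℝ (EuclideanSpace ℝ (Fin k)) G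
      (EuclideanSpace.proj i) (A y (b i)) := by
    funext y
    ext v
    conv_lhs => rw [← b.sum_repr v, map_sum]
    simp [b]
  rw [hsum]
  exact contMDiffAt_finsetSum fun i _ =>
    (ContinuousLinearMap.contMDiff _).contMDiffAt.comp y₀ (hA (b i))

/-- A smooth bundle map between tangent bundles is smooth in coordinates. -/
theorem contMDiffAt_coordMap {g : N → N'}
    {T : ∀ y, TangentSpace (𝓡 d) y →ₗ[ℝ] TangentSpace (𝓡 d') (g y)}
    (hT : ∀ v : TangentSpace (𝓡 d) y₀, ContMDiffAt (𝓡 d).tangent (𝓡 d').tangent ∞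
      (fun v : TangentBundle (𝓡 d) N =>
        (⟨g v.proj, T v.proj v.snd⟩ : TangentBundle (𝓡 d') N')) ⟨y₀, v⟩) :
    ContMDiffAt (𝓡 d) 𝓘(ℝ, EuclideanSpace ℝ (Fin d) →L[ℝ] EuclideanSpace ℝ (Fin d')) ∞
      (coordMap y₀ g T) y₀ := by
  refine contMDiffAt_clm_of_apply fun v => ?_
  have h := (hT (ofCoord y₀ y₀ v)).comp y₀ (contMDiffAt_ofCoord y₀ v)
  rw [Bundle.contMDiffAt_totalSpace] at h
  refine h.2.congr_of_eventuallyEq ?_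
  filter_upwards [h.1.continuousAt (eventually_mem_chartAt_source (d := d') (g y₀))] with y hy
  exact (toCoord_eq_trivializationAt hy _).symm

theorem contMDiffAt_toCoord {Z : ∀ y : N, TangentSpace (𝓡 d) y}
    (hZ : ContMDiffAt (𝓡 d) (𝓡 d).tangent ∞
      (fun y => (⟨y, Z y⟩ : TangentBundle (𝓡 d) N)) y₀) :
    ContMDiffAt (𝓡 d) 𝓘(ℝ, EuclideanSpace ℝ (Fin d)) ∞ (fun y => toCoord y₀ y (Z y)) y₀ := by
  rw [Bundle.contMDiffAt_totalSpace] at hZ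
  refine hZ.2.congr_of_eventuallyEq ?_
  filter_upwards [eventually_mem_chartAt_source (d := d) y₀] with y hy
  exact (toCoord_eq_trivializationAt hy _).symm

-- Expanding each argument in the standard basis gives a finite sum of products of coordinates with
-- values of `A` on fixed basis vectors.
omit [IsManifold (𝓡 d) ∞ N] in
theorem contMDiffAt_alternatingMap_apply {k l : ℕ}
    {A : N → EuclideanSpace ℝ (Fin k) [⋀^Fin l]→L[ℝ] ℝ} {v : N → Fin l → EuclideanSpace ℝ (Fin k)}
    (hA : ContMDiffAt (𝓡 d) 𝓘(ℝ, EuclideanSpace ℝ (Fin k) [⋀^Fin l]→L[ℝ] ℝ) ∞ A y₀)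
    (hv : ∀ i, ContMDiffAt (𝓡 d) 𝓘(ℝ, EuclideanSpace ℝ (Fin k)) ∞ (fun y => v y i) y₀) :
    ContMDiffAt (𝓡 d) 𝓘(ℝ, ℝ) ∞ (fun y => A y (v y)) y₀ := by
  let b := EuclideanSpace.basisFun (Fin k) ℝ
  have hsum : (fun y => A y (v y)) = fun y => ∑ r : Fin l → Fin k,
      (∏ i, (EuclideanSpace.proj (r i) : EuclideanSpace ℝ (Fin k) →L[ℝ] ℝ) (v y i)) •
        ContinuousAlternatingMap.apply ℝ (EuclideanSpace ℝ (Fin k)) ℝ (fun i => b (r i)) (A y) := by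
    funext y
    have h1 : v y = fun i => ∑ j, (v y i) j • b j := by
      funext i
      conv_lhs => rw [← b.sum_repr (v y i)]
      rfl
    conv_lhs => rw [h1]
    refine ((A y).toMultilinearMap.map_sum fun i j => (v y i) j • b j).trans
      (Finset.sum_congr rfl fun r _ => ?_)
    exact (A y).toMultilinearMap.map_smul_univ _ _
  rw [hsum]
  refine contMDiffAt_finsetSum fun r _ => ?_
  have hprod : ContMDiffAt (𝓡 d) 𝓘(ℝ, ℝ) ∞
      (fun y => ∏ i, (EuclideanSpace.proj (r i) : EuclideanSpace ℝ (Fin k) →L[ℝ] ℝ) (v y i)) y₀ :=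
    contMDiffAt_finsetProd fun i _ =>
      (ContinuousLinearMap.contMDiff _).contMDiffAt.comp y₀ (hv i)
  exact hprod.smul ((ContinuousLinearMap.contMDiff _).contMDiffAt.comp y₀ hA)

theorem chartExpr_extChartAt {k : ℕ} (α : FormField d k N)
    (hy : y ∈ (chartAt (EuclideanSpace ℝ (Fin d)) y₀).source)
    (v : Fin k → EuclideanSpace ℝ (Fin d)) :
    chartExpr α y₀ (extChartAt (𝓡 d) y₀ y) v = α y fun i => ofCoord y₀ y (v i) := by
  have hy' : (extChartAt (𝓡 d) y₀).symm (extChartAt (𝓡 d) y₀ y) = y :=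
    (extChartAt (𝓡 d) y₀).left_inv (by rwa [extChartAt_source])
  have hd : ofCoord y₀ y = mfderiv (𝓡 d) (𝓡 d) (extChartAt (𝓡 d) y₀).symm
      (extChartAt (𝓡 d) y₀ y) := by
    rw [ofCoord, TangentBundle.symmL_trivializationAt hy]
    simp [mfderivWithin_univ]
    rfl
  rw [hd]
  unfold chartExpr
  -- The base point occurs in the type of `α z`, so it is generalised before substituting.
  have hgen : ∀ z (_ : z = y) (T : EuclideanSpace ℝ (Fin d) →L[ℝ] EuclideanSpace ℝ (Fin d)),
      (α z).compContinuousLinearMap T v = α y fun i => T (v i) := by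
    rintro _ rfl T
    rfl
  exact hgen _ hy' _

omit [IsManifold (𝓡 d) ∞ N] in
/-- The values of a smooth form, along a smooth map, on vectors with smooth coordinates. -/
theorem contMDiffAt_form_ofCoord {k : ℕ} {α : FormField d' k N'} (hα : IsSmoothForm α)
    {g : N → N'} (hg : ContMDiffAt (𝓡 d) (𝓡 d') ∞ g y₀) {v : N → Fin k → EuclideanSpace ℝ (Fin d')}
    (hv : ∀ i, ContMDiffAt (𝓡 d) 𝓘(ℝ, EuclideanSpace ℝ (Fin d')) ∞ (fun y => v y i) y₀) :
    ContMDiffAt (𝓡 d) 𝓘(ℝ, ℝ) ∞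
      (fun y => α (g y) fun i => ofCoord (g y₀) (g y) (v y i)) y₀ := by
  have hchart : ContMDiffAt (𝓡 d) 𝓘(ℝ, EuclideanSpace ℝ (Fin d')) ∞
      (fun y => extChartAt (𝓡 d') (g y₀) (g y)) y₀ := contMDiffAt_extChartAt.comp y₀ hg
  have hexpr : ContDiffAt ℝ ∞ (chartExpr α (g y₀)) (extChartAt (𝓡 d') (g y₀) (g y₀)) :=
    (hα (g y₀)).contDiffAt (extChartAt_target_mem_nhds (g y₀))
  refine (contMDiffAt_alternatingMap_apply (hexpr.contMDiffAt.comp y₀ hchart) hv)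
    |>.congr_of_eventuallyEq ?_
  filter_upwards [hg.continuousAt (eventually_mem_chartAt_source (d := d') (g y₀))] with y hy
  exact (chartExpr_extChartAt α hy _).symm

end Coordinates

/-! ### Smoothness of the constraint functions -/

section Smoothness

variable {m n : ℕ} {M F : Type*}
  [TopologicalSpace M] [ChartedSpace (EuclideanSpace ℝ (Fin m)) M] [IsManifold (𝓡 m) ∞ M]
  [TopologicalSpace F] [ChartedSpace (EuclideanSpace ℝ (Fin (m + n))) F]
  [IsManifold (𝓡 (m + n)) ∞ F]
  {S : FieldSystem m n M F} (nabla : Connection S) {y₀ y : F}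

/-- A right inverse of a surjective linear map can be chosen smoothly in the map. -/
theorem exists_smooth_rightInverse {d k l : ℕ} {N : Type*} [TopologicalSpace N]
    [ChartedSpace (EuclideanSpace ℝ (Fin d)) N] {z₀ : N}
    {D : N → EuclideanSpace ℝ (Fin k) →L[ℝ] EuclideanSpace ℝ (Fin l)}
    (hD : ContMDiffAt (𝓡 d)
      𝓘(ℝ, EuclideanSpace ℝ (Fin k) →L[ℝ] EuclideanSpace ℝ (Fin l)) ∞ D z₀)
    (hsurj : Function.Surjective (D z₀)) :
    ∃ R : N → EuclideanSpace ℝ (Fin l) →L[ℝ] EuclideanSpace ℝ (Fin k),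
      ContMDiffAt (𝓡 d) 𝓘(ℝ, EuclideanSpace ℝ (Fin l) →L[ℝ] EuclideanSpace ℝ (Fin k)) ∞ R z₀ ∧
        ∀ᶠ z in 𝓝 z₀, ∀ x, D z (R z x) = x := by
  obtain ⟨R₀, hR₀⟩ := (D z₀).toLinearMap.exists_rightInverse_of_surjective
    (LinearMap.range_eq_top.2 hsurj)
  -- With `R₁` a fixed right inverse at `z₀`, `D z ∘ R₁` is the identity at `z₀`, hence invertible
  -- nearby, and `R z = R₁ ∘ (D z ∘ R₁)⁻¹`.
  let R₁ := LinearMap.toContinuousLinearMap R₀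
  have hone : (D z₀).comp R₁ =
      (ContinuousLinearEquiv.refl ℝ (EuclideanSpace ℝ (Fin l)) :
        EuclideanSpace ℝ (Fin l) →L[ℝ] EuclideanSpace ℝ (Fin l)) :=
    ContinuousLinearMap.ext fun x => LinearMap.congr_fun hR₀ x
  have hDR : ContMDiffAt (𝓡 d) 𝓘(ℝ, EuclideanSpace ℝ (Fin l) →L[ℝ] EuclideanSpace ℝ (Fin l)) ∞
      (fun z => (D z).comp R₁) z₀ := hD.clm_comp contMDiffAt_const
  have hinv : ContMDiffAt (𝓡 d) 𝓘(ℝ, EuclideanSpace ℝ (Fin l) →L[ℝ] EuclideanSpace ℝ (Fin l)) ∞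
      (fun z => ((D z).comp R₁).inverse) z₀ := by
    have h := contDiffAt_map_inverse (n := ∞)
      (ContinuousLinearEquiv.refl ℝ (EuclideanSpace ℝ (Fin l)))
    rw [← hone] at h
    exact h.contMDiffAt.comp z₀ hDR
  refine ⟨fun z => R₁.comp ((D z).comp R₁).inverse, contMDiffAt_const.clm_comp hinv, ?_⟩
  have hev := hDR.continuousAt.eventually
    (p := fun T => T ∈ Set.range ContinuousLinearEquiv.toContinuousLinearMap) (by
      simp only [hone]
      exact (ContinuousLinearEquiv.refl ℝ (EuclideanSpace ℝ (Fin l))).nhds)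
  filter_upwards [hev] with z hz x
  obtain ⟨T, hT⟩ := hz
  rw [← hT, ContinuousLinearMap.inverse_equiv]
  calc D z (R₁ (T.symm x)) = (D z).comp R₁ (T.symm x) := rfl
    _ = x := by rw [← hT]; exact T.apply_symm_apply x

/-- The horizontal lift in the coordinates given by the preferred charts at `y₀` and `κ(y₀)`. -/
noncomputable def liftCoord (y₀ y : F) :
    EuclideanSpace ℝ (Fin m) →L[ℝ] EuclideanSpace ℝ (Fin (m + n)) :=
  LinearMap.toContinuousLinearMap
    ((toCoord y₀ y).toLinearMap ∘ₗ nabla.lift y ∘ₗ (ofCoord (S.κ y₀) (S.κ y)).toLinearMap)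

theorem liftCoord_apply (x : EuclideanSpace ℝ (Fin m)) :
    liftCoord nabla y₀ y x = toCoord y₀ y (nabla.lift y (ofCoord (S.κ y₀) (S.κ y) x)) := rfl

theorem contMDiffAt_coordMap_dκ (S : FieldSystem m n M F) (y₀ : F) :
    ContMDiffAt (𝓡 (m + n))
      𝓘(ℝ, EuclideanSpace ℝ (Fin (m + n)) →L[ℝ] EuclideanSpace ℝ (Fin m)) ∞
      (coordMap y₀ S.κ S.dκ) y₀ :=
  contMDiffAt_coordMap fun v => (S.κ_smooth.contMDiff_tangentMap (m := ∞) (by simp)) ⟨y₀, v⟩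

omit [IsManifold (𝓡 m) ∞ M] [IsManifold (𝓡 (m + n)) ∞ F] in
theorem eventually_κ_mem_source (S : FieldSystem m n M F) (y₀ : F) :
    ∀ᶠ y in 𝓝 y₀, S.κ y ∈ (chartAt (EuclideanSpace ℝ (Fin m)) (S.κ y₀)).source :=
  S.κ_smooth.continuous.continuousAt (eventually_mem_chartAt_source (d := m) (S.κ y₀))

/-- The connection supplies smoothness only of the projection `lift ∘ dκ`. Composing it with a
smooth local right inverse of `dκ` recovers the lift. -/
theorem contMDiffAt_liftCoord (y₀ : F) :
    ContMDiffAt (𝓡 (m + n))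
      𝓘(ℝ, EuclideanSpace ℝ (Fin m) →L[ℝ] EuclideanSpace ℝ (Fin (m + n))) ∞
      (liftCoord nabla y₀) y₀ := by
  have hsurj : Function.Surjective (coordMap y₀ S.κ S.dκ y₀) := fun x => by
    obtain ⟨w, hw⟩ := S.κ_submersion y₀ (ofCoord (S.κ y₀) (S.κ y₀) x)
    refine ⟨toCoord y₀ y₀ w, ?_⟩
    change toCoord _ _ (S.dκ y₀ (ofCoord y₀ y₀ (toCoord y₀ y₀ w))) = x
    rw [ofCoord_toCoord (mem_chart_source _ _)]
    change toCoord _ _ (mfderiv (𝓡 (m + n)) (𝓡 m) S.κ y₀ w) = x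
    rw [hw, toCoord_ofCoord (mem_chart_source _ _)]
  obtain ⟨R, hR, hDR⟩ := exists_smooth_rightInverse (contMDiffAt_coordMap_dκ S y₀) hsurj
  have hH : ContMDiffAt (𝓡 (m + n))
      𝓘(ℝ, EuclideanSpace ℝ (Fin (m + n)) →L[ℝ] EuclideanSpace ℝ (Fin (m + n))) ∞
      (coordMap y₀ id fun y => nabla.lift y ∘ₗ S.dκ y) y₀ :=
    contMDiffAt_coordMap (g := id) (T := fun y => nabla.lift y ∘ₗ S.dκ y)
      fun v => nabla.smooth ⟨y₀, v⟩
  refine (hH.clm_comp hR).congr_of_eventuallyEq ?_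
  filter_upwards [hDR, eventually_κ_mem_source S y₀] with y hy hκ
  ext1 x
  have h : ofCoord (S.κ y₀) (S.κ y) x = S.dκ y (ofCoord y₀ y (R y x)) := by
    conv_lhs => rw [← hy x]
    exact ofCoord_toCoord hκ _
  rw [liftCoord_apply, h]
  rfl

/-- The trace is invariant under conjugation by the chart of `M`, and the charts of `F` cancel in
the composite. -/
theorem contMDiffAt_trace_lift {U : Set F} (hU : IsOpen U) {s : ∀ y : F, DualPairSpace (S.dκ y)}
    (hs : S.IsSmoothDualSection U s) (hy₀ : y₀ ∈ U) :
    ContMDiffAt (𝓡 (m + n)) 𝓘(ℝ, ℝ) ∞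
      (fun y => LinearMap.trace ℝ (TangentSpace (𝓡 m) (S.κ y))
        (((s y).1 : TangentSpace (𝓡 (m + n)) y →ₗ[ℝ] TangentSpace (𝓡 m) (S.κ y)) ∘ₗ
          nabla.lift y)) y₀ := by
  have hA := contMDiffAt_coordMap (y₀ := y₀) (g := S.κ) 
    (T := fun y => ((s y).1 : TangentSpace (𝓡 (m + n)) y →ₗ[ℝ] TangentSpace (𝓡 m) (S.κ y)))
    fun v => hs.1.contMDiffAt (x := ⟨y₀, v⟩)
      ((hU.preimage (FiberBundle.continuous_proj _ _)).mem_nhds hy₀)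
  let tr : (EuclideanSpace ℝ (Fin m) →L[ℝ] EuclideanSpace ℝ (Fin m)) →L[ℝ] ℝ :=
    LinearMap.toContinuousLinearMap
      (LinearMap.trace ℝ (EuclideanSpace ℝ (Fin m)) ∘ₗ ContinuousLinearMap.coeLM ℝ)
  refine (tr.contMDiff.contMDiffAt.comp y₀
    (hA.clm_comp (contMDiffAt_liftCoord nabla y₀))).congr_of_eventuallyEq ?_
  filter_upwards [eventually_mem_chartAt_source (d := m + n) y₀, eventually_κ_mem_source S y₀]
    with y hy hκ
  let Q : TangentSpace (𝓡 m) (S.κ y) ≃ₗ[ℝ] EuclideanSpace ℝ (Fin m) :=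
    LinearEquiv.ofLinearMap (toCoord (S.κ y₀) (S.κ y)).toLinearMap
      (ofCoord (S.κ y₀) (S.κ y)).toLinearMap (LinearMap.ext fun x => toCoord_ofCoord hκ x)
      (LinearMap.ext fun x => ofCoord_toCoord hκ x)
  rw [← LinearMap.trace_conj' _ Q]
  refine congrArg (LinearMap.trace ℝ (EuclideanSpace ℝ (Fin m))) (LinearMap.ext fun x => ?_)
  change toCoord (S.κ y₀) (S.κ y) ((s y).1.1 (nabla.lift y (ofCoord (S.κ y₀) (S.κ y) x))) =
    toCoord (S.κ y₀) (S.κ y) ((s y).1.1 (ofCoord y₀ y (liftCoord nabla y₀ y x)))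
  rw [liftCoord_apply, ofCoord_toCoord hy]

theorem contMDiffAt_gammaForm {Z : ∀ y : F, TangentSpace (𝓡 (m + n)) y}
    (hZ : ContMDiffAt (𝓡 (m + n)) (𝓡 (m + n)).tangent ∞
      (fun y => (⟨y, Z y⟩ : TangentBundle (𝓡 (m + n)) F)) y₀) :
    ContMDiffAt (𝓡 (m + n)) 𝓘(ℝ, ℝ) ∞
      (fun y => gammaForm (frame m (S.κ y)) (S.η (S.κ y)).toAlternatingMap
        (S.Ω y).toAlternatingMap (nabla.lift y) (Z y)) y₀ := by
  let b := (EuclideanSpace.basisFun (Fin m) ℝ).toBasis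
  have hη : ContMDiffAt (𝓡 (m + n)) 𝓘(ℝ, ℝ) ∞
      (fun y => S.η (S.κ y) fun i => ofCoord (S.κ y₀) (S.κ y) (b i)) y₀ :=
    contMDiffAt_form_ofCoord S.η_smooth (v := fun _ i => b i) S.κ_smooth.contMDiffAt
      fun i => contMDiffAt_const
  have hΩ : ContMDiffAt (𝓡 (m + n)) 𝓘(ℝ, ℝ) ∞
      (fun y => S.Ω y fun i => ofCoord y₀ y
        ((Fin.snoc (fun a => liftCoord nabla y₀ y (b a)) (toCoord y₀ y (Z y)) :
          Fin (m + 1) → EuclideanSpace ℝ (Fin (m + n))) i)) y₀ := by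
    refine contMDiffAt_form_ofCoord (g := id) S.Ω_smooth contMDiffAt_id fun i => ?_
    refine Fin.lastCases ?_ (fun a => ?_) i
    · simpa only [Fin.snoc_last] using contMDiffAt_toCoord hZ
    · simpa only [Fin.snoc_castSucc] using
        (contMDiffAt_liftCoord nabla y₀).clm_apply contMDiffAt_const
  -- `frame` refers to the preferred chart at each point and need not vary continuously; it is
  -- replaced by the coordinate basis of the single chart at `κ(y₀)`, which leaves `γ` unchanged.
  let B : ∀ y, S.κ y ∈ (chartAt (EuclideanSpace ℝ (Fin m)) (S.κ y₀)).source →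
      Module.Basis (Fin m) ℝ (TangentSpace (𝓡 m) (S.κ y)) := fun y hκ =>
    b.map (LinearEquiv.ofLinearMap (ofCoord (S.κ y₀) (S.κ y)).toLinearMap
      (toCoord (S.κ y₀) (S.κ y)).toLinearMap (LinearMap.ext fun x => ofCoord_toCoord hκ x)
      (LinearMap.ext fun x => toCoord_ofCoord hκ x))
  have hB : ∀ y hκ a, B y hκ a = ofCoord (S.κ y₀) (S.κ y) (b a) := fun y hκ a => b.map_apply _ a
  have hne : (S.η (S.κ y₀) fun i => ofCoord (S.κ y₀) (S.κ y₀) (b i)) ≠ 0 := by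
    have h := (S.η (S.κ y₀)).toAlternatingMap.map_basis_ne_zero_iff
      (B y₀ (mem_chart_source _ _)) |>.2 fun h0 => S.η_ne_zero (S.κ y₀)
        (ContinuousAlternatingMap.toAlternatingMap_injective h0)
    exact h
  refine ((hη.inv₀ hne).mul hΩ).congr_of_eventuallyEq ?_
  filter_upwards [eventually_mem_chartAt_source (d := m + n) y₀, eventually_κ_mem_source S y₀]
    with y hy hκ
  rw [gammaForm_apply_eq_of_basis _ (B y hκ), contract_apply]
  refine congrArg₂ (· * ·) rfl (congrArg (S.Ω y) (funext fun i => ?_))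
  refine Fin.lastCases ?_ (fun a => ?_) i
  · rw [Fin.snoc_last, Fin.snoc_last, ofCoord_toCoord hy]
  · rw [Fin.snoc_castSucc, Fin.snoc_castSucc, liftCoord_apply, ofCoord_toCoord hy, hB y hκ]

/-- The constraint functions are smooth. -/
theorem contMDiffOn_constraint {U : Set F} (hU : IsOpen U)
    {s : ∀ y : F, DualPairSpace (S.dκ y)} (hs : S.IsSmoothDualSection U s) :
    ContMDiffOn (𝓡 (m + n)) 𝓘(ℝ, ℝ) ∞ (S.constraint nabla s) U := by
  intro y₀ hy₀
  have h := (contMDiffAt_trace_lift nabla hU hs hy₀).sub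
    (contMDiffAt_gammaForm nabla (hs.2.contMDiffAt (hU.mem_nhds hy₀)))
  refine (h.congr_of_eventuallyEq (Filter.Eventually.of_forall fun y => ?_)).contMDiffWithinAt
  exact (sub_eq_add_neg _ _).symm

end Smoothness

/-! ### The linear results on tangent spaces, and the theorem -/

section Pointwise

variable {m n : ℕ} {M F : Type*}
  [TopologicalSpace M] [ChartedSpace (EuclideanSpace ℝ (Fin m)) M]
  [TopologicalSpace F] [ChartedSpace (EuclideanSpace ℝ (Fin (m + n))) F]
  [IsManifold (𝓡 (m + n)) ∞ F]
  {S : FieldSystem m n M F}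

theorem flatAt_eq_targetAt_iff (hS : S.VanishesOnThreeVertical) (nabla : Connection S) (y : F)
    (C : Submodule ℝ (TangentSpace (𝓡 (m + n)) y)) (h : TangentSpace (𝓡 m) (S.κ y) →ₗ[ℝ] C) :
    S.flatAt nabla y C h = S.targetAt nabla y ↔ S.SolvesFieldEquations y C h :=
  flat_eq_target_iff (nabla.isSection y)
    (fun h0 => S.η_ne_zero (S.κ y) (ContinuousAlternatingMap.toAlternatingMap_injective h0))
    (fun v i j k => hS y v i j k) h

theorem exists_flatAt_eq_targetAt_iff (nabla : Connection S) (C : Set F) (y : F) :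
    (∃ h, S.flatAt nabla y (tangentTo C y) h = S.targetAt nabla y) ↔
      ∀ p ∈ S.tangentOrth nabla C y,
        pairing (S.dκ y) (nabla.lift y) p (S.targetAt nabla y) = 0 :=
  haveI : FiniteDimensional ℝ (TangentSpace (𝓡 m) (S.κ y)) :=
    inferInstanceAs (FiniteDimensional ℝ (EuclideanSpace ℝ (Fin m)))
  haveI : FiniteDimensional ℝ (TangentSpace (𝓡 (m + n)) y) :=
    inferInstanceAs (FiniteDimensional ℝ (EuclideanSpace ℝ (Fin (m + n))))
  exists_flat_eq_iff (nabla.isSection y) _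

end Pointwise

end PreMultisymplectic

open PreMultisymplectic in
theorem mainTheorem3 {m n : ℕ} (hm : 1 < m) {M F : Type*}
    [TopologicalSpace M] [T2Space M] [ParacompactSpace M]
    [ChartedSpace (EuclideanSpace ℝ (Fin m)) M] [IsManifold (𝓡 m) ∞ M]
    [TopologicalSpace F] [T2Space F] [ParacompactSpace F]
    [ChartedSpace (EuclideanSpace ℝ (Fin (m + n))) F] [IsManifold (𝓡 (m + n)) ∞ F]
    (S : FieldSystem m n M F) (hS : S.VanishesOnThreeVertical) (nabla : Connection S)
    (hC : ∀ i, IsRegularSubmanifold (d := m + n) (S.constraintSet nabla i)) (i : ℕ) :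
    -- `C_{i+1}` is the set of points of `C_i` with a solution of the field equations in `T C_i`
    (S.constraintSet nabla (i + 1) = {y | y ∈ S.constraintSet nabla i ∧
      ∃ h, S.SolvesFieldEquations y (tangentTo (S.constraintSet nabla i) y) h}) ∧
    -- intrinsic description of `C_{i+1}`
    (S.constraintSet nabla (i + 1) = {y | y ∈ S.constraintSet nabla i ∧
      ∀ p ∈ S.tangentOrth nabla (S.constraintSet nabla i) y,
        pairing (S.dκ y) (nabla.lift y) p (S.targetAt nabla y) = 0}) ∧
    -- local description by the constraint functions
    (∀ r : ℕ,
      (∀ y ∈ S.constraintSet nabla i,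
        Module.finrank ℝ (S.tangentOrth nabla (S.constraintSet nabla i) y) = r) →
      ∀ (U : Set F), IsOpen U →
      ∀ s : Fin r → ∀ y : F, DualPairSpace (S.dκ y),
        (∀ j, S.IsSmoothDualSection U (s j)) →
        (∀ y ∈ S.constraintSet nabla i ∩ U,
          Submodule.span ℝ (Set.range fun j => s j y) =
            S.tangentOrth nabla (S.constraintSet nabla i) y) →
        (∀ j, ContMDiffOn (𝓡 (m + n)) 𝓘(ℝ, ℝ) ∞ (S.constraint nabla (s j)) U) ∧
        S.constraintSet nabla (i + 1) ∩ U =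
          {y | y ∈ S.constraintSet nabla i ∩ U ∧ ∀ j, S.constraint nabla (s j) y = 0}) := by
  have horth : S.constraintSet nabla (i + 1) = {y | y ∈ S.constraintSet nabla i ∧
      ∀ p ∈ S.tangentOrth nabla (S.constraintSet nabla i) y,
        pairing (S.dκ y) (nabla.lift y) p (S.targetAt nabla y) = 0} :=
    Set.ext fun y => and_congr_right fun _ => exists_flatAt_eq_targetAt_iff nabla _ y
  refine ⟨Set.ext fun y => and_congr_right fun _ => exists_congr fun h =>
    flatAt_eq_targetAt_iff hS nabla y _ h, horth, fun r _ U hU s hs hspan =>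
    ⟨fun j => contMDiffOn_constraint nabla hU (hs j), ?_⟩⟩
  rw [horth]
  ext y
  constructor
  · rintro ⟨⟨hy, h⟩, hyU⟩
    refine ⟨⟨hy, hyU⟩, fun j => h _ ?_⟩
    rw [← hspan y ⟨hy, hyU⟩]
    exact Submodule.subset_span ⟨j, rfl⟩
  · rintro ⟨⟨hy, hyU⟩, h⟩
    refine ⟨⟨hy, fun p hp => ?_⟩, hyU⟩
    rw [← hspan y ⟨hy, hyU⟩] at hp
    -- Pairing with the target is linear in `p`, so its kernel contains the span once it contains
    -- the generators.
    have hle : Submodule.span ℝ (Set.range fun j => s j y) ≤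
        LinearMap.ker ((pairing (S.dκ y) (nabla.lift y)).flip (S.targetAt nabla y)) :=
      Submodule.span_le.2 (by rintro _ ⟨j, rfl⟩; exact h j)
    exact hle hp
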